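/- Let $k$ be an algebraically closed field of characteristic zero. Let $D$ be a division $k$-algebra that is finite-dimensional over its center $K$, where $K$ is a finitely generated field extension of $k$, and let $n$ be the degree of $D$, i.e. $\dim_K D = n^2$. Let $G$ be a linear algebraic group over $k$ (a Zariski closed subgroup of some $\mathrm{GL}_m(k)$), and suppose that $G$, regarded as an abstract group, acts on $D$ by inner automorphisms; that is, we are given a homomorphism of abstract groups $\rho\colon G\to \mathrm{Aut}_k(D)$, not assumed to be algebraic in any sense, such that for every $g\in G$ there is $a\in D^\ast$ with $\rho(g)(x)=axa^{-1}$ for all $x\in D$. Let $N=\ker\rho$. Then $N$ contains the identity component $G^0$ of $G$ (for the Zariski topology), and $G/N$ is a finite abelian $n$-torsion group, i.e. $G/N$ is finite and abelian and $a^n=1$ for every $a\in G/N$. -/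

import Mathlib

/-- The common zero locus in `GL_m(k)` of a set of polynomials in the `m²` matrix entries. -/
def glZeroLocus {k : Type*} [Field k] {m : ℕ} (S : Set (MvPolynomial (Fin m × Fin m) k)) :
    Set (GL (Fin m) k) :=
  {g | ∀ p ∈ S, MvPolynomial.eval (fun ij : Fin m × Fin m => g.val ij.1 ij.2) p = 0}

/-- The Zariski topology on `GL_m(k)`: the closed sets are the zero loci of sets of polynomials
in the matrix entries, i.e. the topology is the one induced from the affine space of
`m × m` matrices. -/
@[reducible] def glZariskiTopology (k : Type*) [Field k] (m : ℕ) : TopologicalSpace (GL (Fin m) k) :=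
  TopologicalSpace.ofClosed
    (Set.range (glZeroLocus : Set (MvPolynomial (Fin m × Fin m) k) → Set (GL (Fin m) k)))
    (by
      refine ⟨{1}, ?_⟩
      ext g
      simp [glZeroLocus])
    (by
      intro A hA
      refine ⟨{p | ∃ S : Set (MvPolynomial (Fin m × Fin m) k), glZeroLocus S ∈ A ∧ p ∈ S}, ?_⟩
      ext g
      constructor
      · intro hg Z hZ
        obtain ⟨S, rfl⟩ := hA hZ
        exact fun p hp => hg p ⟨S, hZ, hp⟩
      · rintro hg p ⟨S, hS, hp⟩
        exact hg _ hS p hp)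
    (by
      rintro _ ⟨S, rfl⟩ _ ⟨T, rfl⟩
      refine ⟨{r | ∃ p ∈ S, ∃ q ∈ T, r = p * q}, ?_⟩
      ext g
      constructor
      · intro hg
        by_contra hcon
        simp only [glZeroLocus, Set.mem_union, Set.mem_ofPred_eq, not_or, not_forall] at hcon
        obtain ⟨⟨p, hp, hp0⟩, q, hq, hq0⟩ := hcon
        have h := hg (p * q) ⟨p, hp, q, hq, rfl⟩
        rw [map_mul] at h
        exact (mul_ne_zero hp0 hq0) h
      · rintro (hg | hg) _ ⟨p, hp, q, hq, rfl⟩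
        · rw [map_mul, hg p hp, zero_mul]
        · rw [map_mul, hg q hq, mul_zero])

/-- A linear algebraic group over an algebraically closed field `k`, as a group of `k`-points:
a Zariski closed subgroup of some `GL_m(k)`. -/
def IsLinearAlgebraicGroup {k : Type*} [Field k] {m : ℕ} (G : Subgroup (GL (Fin m) k)) : Prop :=
  @IsClosed _ (glZariskiTopology k m) (G : Set (GL (Fin m) k))

/-- The identity component `G⁰`: the connected component of `1` in `G`, for the Zariski topology
(the subspace topology from `GL_m(k)`). -/
def identityComponent {k : Type*} [Field k] {m : ℕ} (G : Subgroup (GL (Fin m) k)) : Set G :=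
  @connectedComponent G ((glZariskiTopology k m).induced Subtype.val) 1

/-- An automorphism of a `k`-algebra is inner if it is conjugation by an invertible element. -/
def IsInnerAut {k D : Type*} [Field k] [Ring D] [Algebra k D] (φ : D ≃ₐ[k] D) : Prop :=
  ∃ a : Dˣ, ∀ x : D, φ x = (a : D) * x * ((a⁻¹ : Dˣ) : D)

/-! The proof shows first that a divisible abelian group acts trivially (`eq_one_of_divisible`). Its
conjugators commute up to roots of unity, which divisibility kills, so they generate a commutative
field `L` finite over `K`. Each conjugator is divisible modulo `K`. Dividing a power of it by its
norm gives an element of `L` with roots of every order, and in a finitely generated extension of `k`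
only constants have these. Hence the conjugators lie in `K`.

Each `g` in `G` lies in a closed abelian subgroup, a finite-index part of which is irreducible.
Power maps are dominant there in characteristic zero, so this part is divisible and acts trivially.
Thus a conjugator `a` for `g` has finite order modulo `K`. Counting eigenspaces of conjugation by
`a` shows that this order divides `n` (`exists_algebraMap_eq_pow_degree`), so `n`-th powers of `G`
act trivially.

An irreducible closed subgroup of finite index in `G` contains the identity component, and its
elements are quotients of `n`-th powers (`exists_pow_mul_inv_pow`), so it lies in the kernel and the
quotient is finite. Schur's theorem then makes commutators of conjugators torsion, hence scalars
from `k`, and the quotient is abelian. -/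

open TopologicalSpace Topology

/-! ### Irreducible components of Noetherian groups -/

section GroupTopology

variable {X : Type*} [Group X] [TopologicalSpace X]

theorem image_mulLeft_mem_irreducibleComponents (hc : ∀ g : X, Continuous (fun x => g * x)) (g : X)
    {Z : Set X} (hZ : Z ∈ irreducibleComponents X) :
    (fun x => g * x) '' Z ∈ irreducibleComponents X := by
  refine ⟨hZ.1.image _ (hc g).continuousOn, fun W hW hle => ?_⟩
  have h1 : (fun x => g⁻¹ * x) '' W ⊆ Z := by
    refine hZ.2 (hW.image _ (hc g⁻¹).continuousOn) ?_
    intro z hz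
    exact ⟨g * z, hle ⟨z, hz, rfl⟩, by simp⟩
  intro w hw
  exact ⟨g⁻¹ * w, h1 ⟨w, hw, rfl⟩, by simp⟩

/-- In a Noetherian group with continuous left translations, an irreducible component of the
space is a neighbourhood of each of its points, and distinct components are disjoint. -/
theorem irreducibleComponents_disjoint_open [NoetherianSpace X]
    (hc : ∀ g : X, Continuous (fun x => g * x)) {Z : Set X} (hZ : Z ∈ irreducibleComponents X)
    {y : X} (hy : y ∈ Z) :
    Z ∈ nhds y ∧ ∀ W ∈ irreducibleComponents X, y ∈ W → W = Z := by
  -- Some point of `Z` has an open neighbourhood inside `Z`; translation carries this neighbourhood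
  -- to `y`.
  obtain ⟨o, ho, ⟨x, hx⟩, hoZ⟩ := NoetherianSpace.exists_isOpen_nonempty_subset_irreducibleComponent Z hZ
  set g := y * x⁻¹ with hg
  have hopen : IsOpen ((fun x => g * x) '' o) := by
    have : (fun x => g * x) '' o = (fun x => g⁻¹ * x) ⁻¹' o := by
      ext w
      constructor
      · rintro ⟨v, hv, rfl⟩
        simpa using hv
      · intro hw
        exact ⟨g⁻¹ * w, hw, by simp⟩
    rw [this]
    exact ho.preimage (hc _)
  have hyo : y ∈ (fun x => g * x) '' o := ⟨x, hx, by simp [hg]⟩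
  have hgZ := image_mulLeft_mem_irreducibleComponents hc g hZ
  have hsub : (fun x => g * x) '' o ⊆ (fun x => g * x) '' Z := Set.image_mono hoZ
  have key : ∀ W ∈ irreducibleComponents X, y ∈ W → W = (fun x => g * x) '' Z := by
    intro W hW hyW
    -- A nonempty open part of an irreducible set is dense in it, so any component through `y` lies
    -- in the translated one.
    have h1 : W ⊆ closure (W ∩ (fun x => g * x) '' o) := by
      intro w hw
      refine mem_closure_iff.2 fun V hV hwV => ?_
      obtain ⟨v, hvW, hvV, hvo⟩ := hW.1.2 V _ hV hopen ⟨w, hw, hwV⟩ ⟨y, hyW, hyo⟩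
      exact ⟨v, hvV, hvW, hvo⟩
    have h2 : W ⊆ (fun x => g * x) '' Z := by
      refine h1.trans (closure_minimal ?_ (isClosed_of_mem_irreducibleComponents _ hgZ))
      exact Set.inter_subset_right.trans hsub
    exact Set.Subset.antisymm h2 (hW.2 hgZ.1 h2)
  have hZg := key Z hZ hy
  refine ⟨?_, fun W hW hyW => (key W hW hyW).trans hZg.symm⟩
  rw [hZg]
  exact Filter.mem_of_superset (hopen.mem_nhds hyo) hsub

/-- A Noetherian group with continuous left translations has an irreducible clopen subgroup of
finite index. -/
theorem exists_irreducible_clopen_subgroup [NoetherianSpace X]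
    (hc : ∀ g : X, Continuous (fun x => g * x)) :
    ∃ Z : Subgroup X, IsClopen (Z : Set X) ∧ IsIrreducible (Z : Set X) ∧ Finite (X ⧸ Z) := by
  set C := irreducibleComponent (1 : X) with hC
  have hCm : C ∈ irreducibleComponents X := irreducibleComponent_mem_irreducibleComponents 1
  have h1C : (1 : X) ∈ C := mem_irreducibleComponent
  -- The translate of `C` by `z⁻¹` is a component through `1`, and there is only one. This makes `C`
  -- a subgroup.
  have hinv : ∀ z ∈ C, (fun x => z⁻¹ * x) '' C = C := by
    intro z hz
    refine (irreducibleComponents_disjoint_open hc hCm h1C).2 _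
      (image_mulLeft_mem_irreducibleComponents hc _ hCm) ⟨z, hz, by simp⟩
  have hinv' : ∀ z ∈ C, z⁻¹ ∈ C := by
    intro z hz
    rw [← hinv z hz]
    exact ⟨1, h1C, by simp⟩
  let Z : Subgroup X :=
    { carrier := C
      one_mem' := h1C
      mul_mem' := by
        intro a b ha hb
        rw [← hinv _ (hinv' a ha)]
        exact ⟨b, hb, by simp⟩
      inv_mem' := by
        intro z hz
        exact hinv' z hz }
  refine ⟨Z, ⟨isClosed_of_mem_irreducibleComponents _ hCm, ?_⟩, hCm.1, ?_⟩
  · exact isOpen_iff_mem_nhds.2 fun y hy => (irreducibleComponents_disjoint_open hc hCm hy).1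
  · have hf : Finite (irreducibleComponents X) := NoetherianSpace.finite_irreducibleComponents
    refine Finite.of_injective (β := irreducibleComponents X)
      (fun q : X ⧸ Z => ⟨(fun x => q.out * x) '' C,
        image_mulLeft_mem_irreducibleComponents hc _ hCm⟩) ?_
    intro p q hpq
    have h : (fun x => p.out * x) '' C = (fun x => q.out * x) '' C := congrArg Subtype.val hpq
    have hq : q.out ∈ (fun x => p.out * x) '' C := by
      rw [h]
      exact ⟨1, h1C, by simp⟩
    obtain ⟨c, hc, hcq⟩ := hq
    rw [← p.out_eq, ← q.out_eq]
    refine QuotientGroup.eq.2 ?_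
    change _ ∈ C
    rw [← hcq]
    simpa using hc

end GroupTopology

/-! ### The Zariski topology on the general linear group -/

section Zariski

variable {k : Type*} [Field k] {m : ℕ}

/-- Evaluation of polynomials in the matrix entries at an invertible matrix. -/
noncomputable abbrev evalGL (g : GL (Fin m) k) : MvPolynomial (Fin m × Fin m) k →+* k :=
  MvPolynomial.eval (fun ij : Fin m × Fin m => g.val ij.1 ij.2)

/-- The point of affine space defined by an invertible matrix. -/
noncomputable def glPoint (g : GL (Fin m) k) : PrimeSpectrum (MvPolynomial (Fin m × Fin m) k) :=
  ⟨RingHom.ker (evalGL g), RingHom.ker_isPrime _⟩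

theorem isClosed_glZariski_iff {C : Set (GL (Fin m) k)} :
    IsClosed[glZariskiTopology k m] C ↔ ∃ S, glZeroLocus S = C := by
  rw [← @isOpen_compl_iff _ _ (glZariskiTopology k m)]
  change Cᶜᶜ ∈ _ ↔ _
  rw [compl_compl]
  rfl

theorem glPoint_preimage_zeroLocus (S : Set (MvPolynomial (Fin m × Fin m) k)) :
    glPoint ⁻¹' (PrimeSpectrum.zeroLocus S) = glZeroLocus S := by
  ext g
  rfl

/-- This transfers Noetherianity from the spectrum of a polynomial ring. -/
theorem glZariskiTopology_eq_induced :
    glZariskiTopology k m = TopologicalSpace.induced glPoint inferInstance := by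
  refine TopologicalSpace.ext_iff_isClosed.2 fun C => ?_
  rw [isClosed_glZariski_iff, isClosed_induced_iff]
  constructor
  · rintro ⟨S, rfl⟩
    exact ⟨_, PrimeSpectrum.isClosed_zeroLocus S, glPoint_preimage_zeroLocus S⟩
  · rintro ⟨t, ht, rfl⟩
    obtain ⟨S, rfl⟩ := (PrimeSpectrum.isClosed_iff_zeroLocus t).1 ht
    exact ⟨S, (glPoint_preimage_zeroLocus S).symm⟩

theorem noetherianSpace_gl : @NoetherianSpace (GL (Fin m) k) (glZariskiTopology k m) := by
  let _ := glZariskiTopology k m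
  exact (Topology.IsInducing.mk glZariskiTopology_eq_induced).noetherianSpace

theorem continuous_mulLeft_gl (h : GL (Fin m) k) :
    @Continuous _ _ (glZariskiTopology k m) (glZariskiTopology k m) (fun g => h * g) := by
  let _ := glZariskiTopology k m
  refine continuous_iff_isClosed.2 fun C hC => ?_
  obtain ⟨S, rfl⟩ := isClosed_glZariski_iff.1 hC
  -- The comorphism of left multiplication by `h`.
  let f : MvPolynomial (Fin m × Fin m) k →ₐ[k] MvPolynomial (Fin m × Fin m) k :=
    MvPolynomial.aeval (fun ij => ∑ l, MvPolynomial.C (h.val ij.1 l) * MvPolynomial.X (l, ij.2))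
  have hf : ∀ (g : GL (Fin m) k) p, evalGL g (f p) = evalGL (h * g) p := by
    intro g p
    have : (evalGL g).comp (f : _ →+* _) = evalGL (h * g) := by
      refine MvPolynomial.ringHom_ext ?_ ?_
      · intro r
        simp [f]
      · intro i
        simp [f, Matrix.mul_apply]
    exact congrArg (fun F => F p) this
  refine isClosed_glZariski_iff.2 ⟨f '' S, ?_⟩
  ext g
  simp only [glZeroLocus, Set.mem_preimage, Set.mem_ofPred_eq, Set.forall_mem_image]
  exact forall₂_congr fun p _ => by rw [← hf g p]

theorem isClosed_centralizer_gl (T : Set (GL (Fin m) k)) :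
    IsClosed[glZariskiTopology k m] (Subgroup.centralizer T : Set (GL (Fin m) k)) := by
  refine isClosed_glZariski_iff.2 ⟨{p | ∃ t ∈ T, ∃ i j,
    p = ∑ l, MvPolynomial.C (t.val i l) * MvPolynomial.X (l, j) -
      ∑ l, MvPolynomial.X (i, l) * MvPolynomial.C (t.val l j)}, ?_⟩
  ext g
  simp only [SetLike.mem_coe, Subgroup.mem_centralizer_iff]
  constructor
  · intro h t ht
    refine Units.ext (Matrix.ext fun i j => ?_)
    have := h _ ⟨t, ht, i, j, rfl⟩
    simp only [map_sub, map_sum, map_mul, MvPolynomial.eval_C, MvPolynomial.eval_X,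
      sub_eq_zero] at this
    simp only [Units.val_mul, Matrix.mul_apply, this]
  · rintro h _ ⟨t, ht, i, j, rfl⟩
    have := congrArg (fun u : GL (Fin m) k => u.val i j) (h t ht)
    simp only [Units.val_mul, Matrix.mul_apply] at this
    simp only [map_sub, map_sum, map_mul, MvPolynomial.eval_C, MvPolynomial.eval_X, this,
      sub_self]

/-- A Zariski closed subgroup of `GL_m(k)` contains a closed irreducible subgroup of finite index,
and the identity component lies in it. -/
theorem exists_irreducible_finite_index (G : Subgroup (GL (Fin m) k))
    (hG : IsLinearAlgebraicGroup G) :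
    ∃ Z : Subgroup (GL (Fin m) k), Z ≤ G ∧ IsLinearAlgebraicGroup Z ∧
      @IsIrreducible _ (glZariskiTopology k m) (Z : Set (GL (Fin m) k)) ∧
      Finite (G ⧸ Z.subgroupOf G) ∧ identityComponent G ⊆ (Z.subgroupOf G : Set G) := by
  let _ := glZariskiTopology k m
  have := noetherianSpace_gl (k := k) (m := m)
  have : NoetherianSpace G := Topology.IsInducing.subtypeVal.noetherianSpace
  have hc : ∀ g : G, Continuous (fun x : G => g * x) := fun g =>
    ((continuous_mulLeft_gl (g : GL (Fin m) k)).comp continuous_subtype_val).subtype_mk _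
  obtain ⟨Z, hZ, hirr, hfin⟩ := exists_irreducible_clopen_subgroup hc
  have hcoe : ((Z.map G.subtype : Subgroup _) : Set (GL (Fin m) k)) = Subtype.val '' (Z : Set G) :=
    rfl
  have hsub : (Z.map G.subtype).subgroupOf G = Z := by
    ext x
    simp [Subgroup.mem_subgroupOf]
  refine ⟨Z.map G.subtype, ?_, ?_, ?_, ?_, ?_⟩
  · exact Subgroup.map_subtype_le Z
  · unfold IsLinearAlgebraicGroup
    rw [hcoe]
    exact (IsClosed.isClosedEmbedding_subtypeVal hG).isClosedMap _ hZ.1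
  · rw [hcoe]
    exact hirr.image _ continuous_subtype_val.continuousOn
  · rwa [hsub]
  · rw [hsub]
    exact hZ.connectedComponent_subset Z.one_mem

end Zariski

/-! ### Dominance of power maps in characteristic zero -/

/-- In a space with a generic point `η`, a constructible set containing `η` is a neighbourhood
of it. -/
theorem mem_nhds_of_isConstructible {X : Type*} [TopologicalSpace X] {η : X}
    (hη : ∀ U : Set X, IsOpen U → U.Nonempty → η ∈ U) {s : Set X} (hs : IsConstructible s)
    (h : η ∈ s) : s ∈ 𝓝 η := by
  -- The dichotomy, unlike the claim itself, is stable under complements, so it can be proved by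
  -- induction.
  have key : s ∈ 𝓝 η ∨ sᶜ ∈ 𝓝 η := by
    clear h
    induction hs using IsConstructible.empty_union_induction with
    | open_retrocompact U hU _ =>
      rcases U.eq_empty_or_nonempty with rfl | hne
      · simp
      · exact Or.inl (hU.mem_nhds (hη U hU hne))
    | union s hs t ht h1 h2 =>
      rcases h1 with h1 | h1
      · exact Or.inl (Filter.mem_of_superset h1 Set.subset_union_left)
      · rcases h2 with h2 | h2
        · exact Or.inl (Filter.mem_of_superset h2 Set.subset_union_right)
        · rw [Set.compl_union]
          exact Or.inr (Filter.inter_mem h1 h2)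
    | compl s hs h1 =>
      rw [compl_compl]
      exact h1.symm
  exact key.resolve_right fun h' => mem_of_mem_nhds h' h

/-- `P` acts on `I ^ j / I ^ (j + 1)` as the unit `e ^ j`, so an element of its kernel lies in every
`I ^ j`, and Krull's intersection theorem gives zero. It is applied at the identity of a group,
where the `e`-th power map has differential `e`; no smoothness is needed. -/
theorem injective_of_sub_natCast_mul_mem_sq {k R : Type*} [Field k] [CharZero k] [CommRing R]
    [IsDomain R] [IsNoetherianRing R] [Algebra k R] (P : R →+* R) (I : Ideal R) (hI : I ≠ ⊤)
    (hk : ∀ c : k, P (algebraMap k R c) = algebraMap k R c)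
    (haug : ∀ p : R, ∃ c : k, p - algebraMap k R c ∈ I) {e : ℕ} (he : e ≠ 0)
    (hP : ∀ x ∈ I, P x - e * x ∈ I ^ 2) : Function.Injective P := by
  have hPI : ∀ x ∈ I, P x ∈ I := by
    intro x hx
    have := I.add_mem (Ideal.pow_le_self two_ne_zero (hP x hx)) (I.mul_mem_left (e : R) hx)
    simpa using this
  have key : ∀ j : ℕ, ∀ p ∈ I ^ j, P p - (e : R) ^ j * p ∈ I ^ (j + 1) := by
    intro j
    induction j with
    | zero =>
      intro p _
      obtain ⟨c, hc⟩ := haug p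
      have h := I.sub_mem (hPI _ hc) hc
      rw [map_sub, hk] at h
      simpa using h
    | succ j ih =>
      intro p hp
      rw [pow_succ] at hp
      induction hp using Submodule.mul_induction_on' with
      | mem_mul_mem x hx y hy =>
        have h1 : (P x - (e : R) ^ j * x) * P y ∈ I ^ (j + 1 + 1) := by
          rw [pow_succ]
          exact Ideal.mul_mem_mul (ih x hx) (hPI y hy)
        have h2 : (e : R) ^ j * (x * (P y - e * y)) ∈ I ^ (j + 1 + 1) := by
          rw [add_assoc, pow_add]
          exact Ideal.mul_mem_left _ _ (Ideal.mul_mem_mul hx (hP y hy))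
        have := Ideal.add_mem _ h1 h2
        convert this using 1
        rw [map_mul]
        ring
      | add x _ y _ hx hy =>
        convert Ideal.add_mem _ hx hy using 1
        rw [map_add]
        ring
  have he' : ∀ j : ℕ, IsUnit ((e : R) ^ j) := by
    intro j
    have : IsUnit (algebraMap k R (e : k)) := (IsUnit.mk0 _ (Nat.cast_ne_zero.2 he)).map _
    rw [map_natCast] at this
    exact this.pow j
  rw [injective_iff_map_eq_zero]
  intro p hp
  have hall : ∀ j : ℕ, p ∈ I ^ j := by
    intro j
    induction j with
    | zero => simp
    | succ j ih =>
      have h := key j p ih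
      rw [hp, zero_sub, neg_mem_iff] at h
      exact (Ideal.unit_mul_mem_iff_mem _ (he' j)).1 h
  have : p ∈ ⨅ j : ℕ, I ^ j := (Submodule.mem_iInf _).2 hall
  have hbot : (⨅ j : ℕ, I ^ j) = ⊥ := Ideal.iInf_pow_eq_bot_of_isDomain I hI
  rwa [hbot] at this

section PowerMap

variable {k : Type*} [Field k] {m : ℕ}

/-- The comorphism of the `e`-th power map on matrices. -/
noncomputable def powComorphism (k : Type*) [Field k] (m e : ℕ) :
    MvPolynomial (Fin m × Fin m) k →ₐ[k] MvPolynomial (Fin m × Fin m) k :=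
  MvPolynomial.aeval (fun ij => (Matrix.mvPolynomialX (Fin m) (Fin m) k ^ e) ij.1 ij.2)

theorem eval_powComorphism (e : ℕ) (x : Fin m × Fin m → k) (p : MvPolynomial (Fin m × Fin m) k) :
    MvPolynomial.eval x (powComorphism k m e p) =
      MvPolynomial.eval (fun ij : Fin m × Fin m => ((Matrix.of fun i j => x (i, j)) ^ e) ij.1 ij.2) p := by
  have hX : (Matrix.mvPolynomialX (Fin m) (Fin m) k).map (MvPolynomial.eval x) =
      Matrix.of fun i j => x (i, j) := by
    ext i j
    simp
  have : (MvPolynomial.eval x).comp (powComorphism k m e).toRingHom =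
      MvPolynomial.eval (fun ij : Fin m × Fin m => ((Matrix.of fun i j => x (i, j)) ^ e) ij.1 ij.2) := by
    refine MvPolynomial.ringHom_ext ?_ ?_
    · intro r
      simp [powComorphism]
    · intro i
      simp only [powComorphism, RingHom.comp_apply, AlgHom.toRingHom_eq_coe, RingHom.coe_coe, MvPolynomial.aeval_X,
        MvPolynomial.eval_X]
      rw [← hX, ← Matrix.map_pow, Matrix.map_apply]
  exact congrArg (fun F => F p) this

theorem evalGL_powComorphism (e : ℕ) (g : GL (Fin m) k) (p : MvPolynomial (Fin m × Fin m) k) :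
    evalGL g (powComorphism k m e p) = evalGL (g ^ e) p := by
  rw [evalGL, eval_powComorphism]
  simp only [evalGL, Units.val_pow_eq_pow_val]
  rfl

/-- Modulo the square of the maximal ideal, the generic matrix is `1 + Y` with `Y * Y = 0`, so its
`e`-th power is `1 + e • Y`. -/
theorem mvPolynomialX_pow_sub_mem (e : ℕ) (i j : Fin m) :
    (Matrix.mvPolynomialX (Fin m) (Fin m) k ^ e) i j - MvPolynomial.C ((1 : Matrix _ _ k) i j) -
      (e : MvPolynomial (Fin m × Fin m) k) * (MvPolynomial.X (i, j) - MvPolynomial.C ((1 : Matrix _ _ k) i j)) ∈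
      RingHom.ker (evalGL (1 : GL (Fin m) k)) ^ 2 := by
  set M := RingHom.ker (evalGL (1 : GL (Fin m) k)) with hM
  let π := Ideal.Quotient.mk (M ^ 2)
  set Y : Matrix (Fin m) (Fin m) (MvPolynomial (Fin m × Fin m) k ⧸ M ^ 2) :=
    (Matrix.mvPolynomialX (Fin m) (Fin m) k).map π - 1 with hY
  have hYij : ∀ i j, Y i j =
      π (MvPolynomial.X (i, j) - MvPolynomial.C ((1 : Matrix _ _ k) i j)) := by
    intro i j
    by_cases h : i = j
    · subst h
      simp [hY]
    · simp [hY, h]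
  have hYY : Y * Y = 0 := by
    ext i j
    rw [Matrix.mul_apply, Matrix.zero_apply]
    refine Finset.sum_eq_zero fun l _ => ?_
    rw [hYij, hYij, ← map_mul]
    refine Ideal.Quotient.eq_zero_iff_mem.2 ?_
    rw [pow_two]
    refine Ideal.mul_mem_mul ?_ ?_ <;> simp [hM, RingHom.mem_ker]
  have hpow : ∀ r : ℕ, (1 + Y) ^ r = 1 + r • Y := by
    clear_value Y
    intro r
    induction r with
    | zero => simp
    | succ r ih =>
      rw [pow_succ (1 + Y) r, ih, add_mul, mul_add, mul_add, smul_mul_assoc, smul_mul_assoc, hYY, succ_nsmul]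
      simp only [one_mul, mul_one, smul_zero, add_zero]
      abel
  have h1 : (1 + Y) = (Matrix.mvPolynomialX (Fin m) (Fin m) k).map π := by
    rw [hY]
    abel
  have h2 := congrArg (fun A => A i j) (hpow e)
  rw [h1, ← Matrix.map_pow] at h2
  simp only [Matrix.map_apply, Matrix.add_apply, Matrix.smul_apply, hYij] at h2
  refine Ideal.Quotient.eq_zero_iff_mem.1 ?_
  change π _ = 0
  rw [map_sub, map_sub, h2, map_mul, map_natCast, nsmul_eq_mul]
  by_cases h : i = j
  · subst h
    simp
  · simp [h]

theorem powComorphism_sub_mem (e : ℕ) (p : MvPolynomial (Fin m × Fin m) k) :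
    powComorphism k m e p - MvPolynomial.C (evalGL 1 p) -
      (e : MvPolynomial (Fin m × Fin m) k) * (p - MvPolynomial.C (evalGL 1 p)) ∈ RingHom.ker (evalGL (1 : GL (Fin m) k)) ^ 2 := by
  set M := RingHom.ker (evalGL (1 : GL (Fin m) k)) with hM
  induction p using MvPolynomial.induction_on with
  | C a => simp [powComorphism]
  | add p q hp hq =>
    convert Ideal.add_mem _ hp hq using 1
    simp only [map_add]
    ring
  | mul_X p ij hp =>
    have hX := mvPolynomialX_pow_sub_mem (k := k) e ij.1 ij.2
    have hΦ : powComorphism k m e (MvPolynomial.X ij) =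
        (Matrix.mvPolynomialX (Fin m) (Fin m) k ^ e) ij.1 ij.2 := by
      simp [powComorphism]
    have hev : evalGL (1 : GL (Fin m) k) (MvPolynomial.X ij) = (1 : Matrix _ _ k) ij.1 ij.2 := by
      simp
    rw [← hΦ, ← hev] at hX
    have hpM : p - MvPolynomial.C (evalGL 1 p) ∈ M := by simp [hM, RingHom.mem_ker]
    have hXM : MvPolynomial.X ij - MvPolynomial.C (evalGL 1 (MvPolynomial.X ij)) ∈ M := by
      simp [hM, RingHom.mem_ker]
    have hprod := Ideal.mul_mem_mul hpM hXM
    rw [← pow_two] at hprod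
    rw [map_mul, map_mul, map_mul]
    set c : MvPolynomial (Fin m × Fin m) k := MvPolynomial.C (evalGL 1 p)
    set d : MvPolynomial (Fin m × Fin m) k := MvPolynomial.C (evalGL 1 (MvPolynomial.X ij))
    have h1 := Ideal.mul_mem_right (powComorphism k m e (MvPolynomial.X ij)) _ hp
    have h2 := Ideal.mul_mem_left _ (c + (e : MvPolynomial (Fin m × Fin m) k) * (p - c)) hX
    -- Expanding the product of the two linear approximations gives the second-order term with
    -- coefficient `e ^ 2`, where the target has `e`.
    have h3 := Ideal.mul_mem_left _ ((e : MvPolynomial (Fin m × Fin m) k) * e - e) hprod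
    convert Ideal.add_mem _ (Ideal.add_mem _ h1 h2) h3 using 1
    ring

end PowerMap

section PowerMap

variable {k : Type*} [Field k] {m : ℕ}

/-- The ideal of polynomials in the matrix entries vanishing on a set of invertible matrices. -/
noncomputable def glVanishingIdeal (Z : Set (GL (Fin m) k)) :
    Ideal (MvPolynomial (Fin m × Fin m) k) :=
  ⨅ g ∈ Z, RingHom.ker (evalGL g)

theorem mem_glVanishingIdeal {Z : Set (GL (Fin m) k)} {p : MvPolynomial (Fin m × Fin m) k} :
    p ∈ glVanishingIdeal Z ↔ ∀ g ∈ Z, evalGL g p = 0 := by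
  simp [glVanishingIdeal, Submodule.mem_iInf, RingHom.mem_ker]

theorem isOpen_evalGL_ne_zero (p : MvPolynomial (Fin m × Fin m) k) :
    IsOpen[glZariskiTopology k m] {g | evalGL g p ≠ 0} := by
  let _ := glZariskiTopology k m
  rw [← isClosed_compl_iff, isClosed_glZariski_iff]
  refine ⟨{p}, ?_⟩
  ext g
  simp [glZeroLocus]

theorem glVanishingIdeal_isPrime {Z : Set (GL (Fin m) k)}
    (hZ : @IsIrreducible _ (glZariskiTopology k m) Z) : (glVanishingIdeal Z).IsPrime := by
  refine Ideal.isPrime_iff.2 ⟨?_, ?_⟩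
  · obtain ⟨g, hg⟩ := hZ.1
    intro h
    have h1 : (1 : MvPolynomial (Fin m × Fin m) k) ∈ glVanishingIdeal Z := h ▸ Submodule.mem_top
    simpa using mem_glVanishingIdeal.1 h1 g hg
  · intro p q hpq
    by_contra h
    rw [not_or, mem_glVanishingIdeal, mem_glVanishingIdeal] at h
    push Not at h
    obtain ⟨g, hg, h1, h2⟩ :=
      hZ.2 _ _ (isOpen_evalGL_ne_zero p) (isOpen_evalGL_ne_zero q) h.1 h.2
    refine mul_ne_zero h1 h2 ?_
    rw [← map_mul]
    exact mem_glVanishingIdeal.1 hpq g hg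

/-- On a closed irreducible subgroup of `GL_m(k)`, in characteristic zero, the image of a power
map contains a nonempty open subset. -/
theorem exists_open_subset_pow [IsAlgClosed k] [CharZero k] {Z : Subgroup (GL (Fin m) k)}
    (hcl : IsLinearAlgebraicGroup Z)
    (hZ : @IsIrreducible _ (glZariskiTopology k m) (Z : Set (GL (Fin m) k))) {e : ℕ} (he : e ≠ 0) :
    ∃ f : MvPolynomial (Fin m × Fin m) k, (∃ g ∈ Z, evalGL g f ≠ 0) ∧
      ∀ g ∈ Z, evalGL g f ≠ 0 → ∃ y ∈ Z, y ^ e = g := by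
  set I := glVanishingIdeal (Z : Set (GL (Fin m) k)) with hI
  have hprime : I.IsPrime := glVanishingIdeal_isPrime hZ
  have hIΦ : I ≤ I.comap (powComorphism k m e) := by
    intro p hp
    refine mem_glVanishingIdeal.2 fun g hg => ?_
    rw [evalGL_powComorphism]
    exact mem_glVanishingIdeal.1 hp _ (Z.pow_mem hg e)
  let π := Ideal.Quotient.mk I
  let P : (MvPolynomial (Fin m × Fin m) k ⧸ I) →ₐ[k] (MvPolynomial (Fin m × Fin m) k ⧸ I) :=
    Ideal.quotientMapₐ I (powComorphism k m e) hIΦ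
  have hPπ : ∀ p, P (π p) = π (powComorphism k m e p) := fun p => rfl
  have hIle : ∀ g ∈ Z, I ≤ RingHom.ker (evalGL g) := fun g hg p hp =>
    mem_glVanishingIdeal.1 hp g hg
  have hπsurj : Function.Surjective π := Ideal.Quotient.mk_surjective
  have hinj : Function.Injective P := by
    refine injective_of_sub_natCast_mul_mem_sq (k := k) (P : _ →+* _)
      ((RingHom.ker (evalGL (1 : GL (Fin m) k))).map π) ?_ ?_ ?_ he ?_
    · intro h
      have h2 := congrArg (Ideal.comap π) h
      rw [Ideal.comap_map_of_surjective' π hπsurj, Ideal.mk_ker,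
        sup_eq_left.2 (hIle 1 Z.one_mem), Ideal.comap_top] at h2
      exact (RingHom.ker_isPrime (evalGL (1 : GL (Fin m) k))).ne_top h2
    · exact P.commutes
    · intro p
      obtain ⟨p, rfl⟩ := hπsurj p
      refine ⟨evalGL 1 p, ?_⟩
      have : π (p - MvPolynomial.C (evalGL 1 p)) ∈
          (RingHom.ker (evalGL (1 : GL (Fin m) k))).map π :=
        Ideal.mem_map_of_mem _ (by simp [RingHom.mem_ker])
      rwa [map_sub] at this
    · intro x hx
      obtain ⟨p, hp, rfl⟩ := (Ideal.mem_map_iff_of_surjective π hπsurj).1 hx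
      have h := Ideal.mem_map_of_mem π (powComorphism_sub_mem e p)
      rw [RingHom.mem_ker.1 hp, Ideal.map_pow] at h
      simpa [hPπ] using h
  have hft : P.toRingHom.FiniteType := by
    refine RingHom.FiniteType.of_comp_finiteType
      (f := algebraMap k (MvPolynomial (Fin m × Fin m) k ⧸ I)) ?_
    rw [AlgHom.toRingHom_eq_coe, AlgHom.comp_algebraMap]
    exact RingHom.finiteType_algebraMap.2 inferInstance
  -- Chevalley: the image of the power map is constructible. Injectivity of `P` puts the generic
  -- point in it, so it contains a basic open set.
  have hcons := PrimeSpectrum.isConstructible_range_comap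
    (RingHom.FinitePresentation.of_finiteType.1 hft)
  let η : PrimeSpectrum (MvPolynomial (Fin m × Fin m) k ⧸ I) := ⟨⊥, Ideal.isPrime_bot⟩
  have hη : η ∈ Set.range (PrimeSpectrum.comap
      (P : (MvPolynomial (Fin m × Fin m) k ⧸ I) →+* (MvPolynomial (Fin m × Fin m) k ⧸ I))) := by
    refine ⟨η, PrimeSpectrum.ext ?_⟩
    exact (RingHom.injective_iff_ker_eq_bot _).1 hinj
  have hgen : ∀ U : Set (PrimeSpectrum (MvPolynomial (Fin m × Fin m) k ⧸ I)),
      IsOpen U → U.Nonempty → η ∈ U := by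
    rintro U hU ⟨x, hx⟩
    refine (PrimeSpectrum.le_iff_specializes η x).1 ?_ |>.mem_open hU hx
    exact (bot_le : (⊥ : Ideal _) ≤ x.asIdeal)
  obtain ⟨_, ⟨f, rfl⟩, hηf, hf⟩ := PrimeSpectrum.isTopologicalBasis_basic_opens.mem_nhds_iff.1
    (mem_nhds_of_isConstructible hgen hcons hη)
  obtain ⟨f, rfl⟩ := hπsurj f
  refine ⟨f, ?_, ?_⟩
  · have hfI : f ∉ I := fun h => hηf (Ideal.Quotient.eq_zero_iff_mem.2 h)
    rw [mem_glVanishingIdeal] at hfI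
    push Not at hfI
    exact hfI
  · intro g hg hgf
    let ev : (MvPolynomial (Fin m × Fin m) k ⧸ I) →+* k :=
      Ideal.Quotient.lift I (evalGL g) (fun p hp => mem_glVanishingIdeal.1 hp g hg)
    have hevπ : ∀ p, ev (π p) = evalGL g p := fun p => Ideal.Quotient.lift_mk _ _ _
    have hevmax : (RingHom.ker ev).IsMaximal := RingHom.ker_isMaximal_of_surjective _ fun c =>
      ⟨π (MvPolynomial.C c), by simp [hevπ]⟩
    obtain ⟨q, hq⟩ := hf (show (⟨RingHom.ker ev, RingHom.ker_isPrime _⟩ :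
      PrimeSpectrum (MvPolynomial (Fin m × Fin m) k ⧸ I)) ∈ _ from by
        change π f ∉ RingHom.ker ev
        rwa [RingHom.mem_ker, hevπ])
    -- The preimage `q` of the point `g` need not be closed. A maximal ideal above it still lies
    -- over `g`, and by the Nullstellensatz it is a matrix `y`.
    obtain ⟨M, hM, hqM⟩ := Ideal.exists_le_maximal q.asIdeal q.isPrime.ne_top
    have hq' : Ideal.comap (P : (MvPolynomial (Fin m × Fin m) k ⧸ I) →+* _) q.asIdeal =
      RingHom.ker ev := congrArg PrimeSpectrum.asIdeal hq
    have hker : RingHom.ker ev ≤ Ideal.comap (P : (MvPolynomial (Fin m × Fin m) k ⧸ I) →+* _) M := by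
      rw [← hq']
      exact Ideal.comap_mono hqM
    have hMmax : (M.comap π).IsMaximal := Ideal.comap_isMaximal_of_surjective π hπsurj
    obtain ⟨y, hy⟩ := MvPolynomial.eq_vanishingIdeal_singleton_of_isMaximal k hMmax
    have hy' : ∀ p, π p ∈ M → MvPolynomial.eval y p = 0 := by
      intro p hp
      have : p ∈ M.comap π := hp
      rw [hy, MvPolynomial.mem_vanishingIdeal_singleton_iff] at this
      simpa [MvPolynomial.aeval_eq_eval] using this
    have hpow : (Matrix.of fun i j => y (i, j)) ^ e = g.val := by
      ext i j
      have h1 : π (powComorphism k m e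
          (MvPolynomial.X (i, j) - MvPolynomial.C (g.val i j))) ∈ M := by
        rw [← hPπ]
        refine hker ?_
        rw [RingHom.mem_ker, hevπ]
        simp
      have h2 := hy' _ h1
      rw [eval_powComorphism] at h2
      simpa [sub_eq_zero] using h2
    -- So far `y` is only a point of the affine space of matrices; it is invertible because its
    -- power `g` is.
    have hunit : IsUnit (Matrix.of fun i j => y (i, j)) := by
      rw [← isUnit_pow_iff he, hpow]
      exact g.isUnit
    obtain ⟨u, hu⟩ := hunit
    refine ⟨u, ?_, Units.ext ?_⟩
    · obtain ⟨S, hS⟩ := isClosed_glZariski_iff.1 hcl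
      change u ∈ (Z : Set (GL (Fin m) k))
      rw [← hS]
      intro p hp
      have hpI : p ∈ I := by
        refine mem_glVanishingIdeal.2 fun g hg => ?_
        rw [← hS] at hg
        exact hg p hp
      have := hy' p (by
        rw [show π p = 0 from Ideal.Quotient.eq_zero_iff_mem.2 hpI]
        exact M.zero_mem)
      rw [hu]
      exact this
    · rw [Units.val_pow_eq_pow_val, hu, hpow]

/-- In characteristic zero, every element of a closed irreducible subgroup `Z` of `GL_m(k)` is a
quotient of two `e`-th powers in `Z`. -/
theorem exists_pow_mul_inv_pow [IsAlgClosed k] [CharZero k] {Z : Subgroup (GL (Fin m) k)}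
    (hcl : IsLinearAlgebraicGroup Z)
    (hZ : @IsIrreducible _ (glZariskiTopology k m) (Z : Set (GL (Fin m) k))) {e : ℕ} (he : e ≠ 0)
    {z : GL (Fin m) k} (hz : z ∈ Z) : ∃ a ∈ Z, ∃ b ∈ Z, z = a ^ e * (b ^ e)⁻¹ := by
  let _ := glZariskiTopology k m
  obtain ⟨f, ⟨g, hg, hgf⟩, hf⟩ := exists_open_subset_pow hcl hZ he
  have hU := isOpen_evalGL_ne_zero f
  -- Two nonempty open subsets of the irreducible `Z` meet: some `w` has both `w` and `z * w` among
  -- the `e`-th powers.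
  have hV := hU.preimage (continuous_mulLeft_gl z)
  obtain ⟨w, hw, hw1, hw2⟩ := hZ.2 _ _ hU hV ⟨g, hg, hgf⟩ ⟨z⁻¹ * g, Z.mul_mem (Z.inv_mem hz) hg, by
    simpa using hgf⟩
  obtain ⟨b, hb, hbw⟩ := hf w hw hw1
  obtain ⟨a, ha, haw⟩ := hf (z * w) (Z.mul_mem hz hw) hw2
  exact ⟨a, ha, b, hb, by rw [haw, hbw, mul_inv_cancel_right]⟩

end PowerMap

/-! ### Infinitely divisible elements of function fields -/

section InfinitelyDivisible

/-- In a finitely generated field extension of an algebraically closed field `k`, an element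
having roots of every order lies in `k`. -/
theorem mem_range_algebraMap_of_forall_exists_pow {k L : Type*} [Field k] [IsAlgClosed k] [Field L]
    [Algebra k L] [Algebra.EssFiniteType k L] {x : L}
    (hx : ∀ e : ℕ, e ≠ 0 → ∃ y : L, y ^ e = x) : ∃ c : k, algebraMap k L c = x := by
  by_contra hnot
  have htr : Transcendental k x := by
    intro halg
    have hmem : x ∈ integralClosure k L := halg.isIntegral
    obtain ⟨c, hc⟩ := (IsAlgClosed.algebraMap_bijective_of_isIntegral
      (k := k) (K := integralClosure k L)).2 ⟨x, hmem⟩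
    exact hnot ⟨c, congrArg Subtype.val hc⟩
  have hs : AlgebraicIndepOn k id ({x} : Set L) :=
    (algebraicIndependent_singleton_iff (⟨x, rfl⟩ : ({x} : Set L))).2 htr
  obtain ⟨B, hxB, hB⟩ := exists_isTranscendenceBasis_superset hs
  have hb : x ∈ B := hxB rfl
  have halg := hB.isAlgebraic_field
  set E := IntermediateField.adjoin k (Set.range (Subtype.val : B → L)) with hE
  have : Algebra.EssFiniteType E L := Algebra.EssFiniteType.of_comp k E L
  have : Module.Finite E L := Algebra.finite_of_essFiniteType_of_isAlgebraic
  obtain ⟨d, hd⟩ : ∃ d, d = Module.finrank E L := ⟨_, rfl⟩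
  have hd0 : d ≠ 0 := hd ▸ Module.finrank_pos.ne'
  -- The norm of `x` to `E` is `x ^ d`, so the norm of `y` is a `(d + 1)`-th root of it. As `d + 1`
  -- does not divide `d`, the prime `X` cannot allow this.
  obtain ⟨y, hy⟩ := hx (d + 1) d.succ_ne_zero
  let φ := hB.1.aevalEquivField
  let X : MvPolynomial B k := MvPolynomial.X ⟨x, hb⟩
  have hX : algebraMap E L (φ (algebraMap _ _ X)) = x := by
    exact (hB.1.aevalEquivField_algebraMap_apply_coe X).trans (MvPolynomial.aeval_X _ _)
  have h1 : (φ.symm (Algebra.norm E y)) ^ (d + 1) =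
      algebraMap (MvPolynomial B k) (FractionRing (MvPolynomial B k)) (X ^ d) := by
    rw [← map_pow, ← map_pow, hy, ← hX, Algebra.norm_algebraMap, ← hd, map_pow,
      AlgEquiv.symm_apply_apply, map_pow]
  obtain ⟨p, hp⟩ := IsIntegrallyClosed.exists_algebraMap_eq_of_isIntegral_pow d.succ_pos
    (x := φ.symm (Algebra.norm E y)) (by rw [h1]; exact isIntegral_algebraMap)
  rw [← hp, ← map_pow] at h1
  have h2 : p ^ (d + 1) = X ^ d := IsFractionRing.injective _ _ h1
  have hprime : Prime X := MvPolynomial.X_prime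
  obtain ⟨q, rfl⟩ : X ∣ p := hprime.dvd_of_dvd_pow (h2 ▸ dvd_pow_self X hd0)
  have h3 : X ^ d * (X * q ^ (d + 1)) = X ^ d * 1 := by
    calc X ^ d * (X * q ^ (d + 1)) = (X * q) ^ (d + 1) := by ring
      _ = X ^ d * 1 := by rw [h2, mul_one]
  have h4 := mul_left_cancel₀ (pow_ne_zero d hprime.ne_zero) h3
  exact hprime.not_isUnit (IsUnit.of_mul_eq_one _ h4)

/-- Let `L / K` be a finite extension with `K` finitely generated over an algebraically closed
field `k`. A set of nonzero elements of `L` that is divisible modulo `K` is contained in `K`. -/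
theorem mem_range_algebraMap_of_divisible_mod {k K L : Type*} [Field k] [IsAlgClosed k] [Field K]
    [Algebra k K] [Algebra.EssFiniteType k K] [Field L] [Algebra K L] [Module.Finite K L]
    {T : Set L} (h0 : ∀ a ∈ T, a ≠ 0)
    (hT : ∀ a ∈ T, ∀ e : ℕ, e ≠ 0 → ∃ b ∈ T, ∃ c : K, a = algebraMap K L c * b ^ e)
    {a : L} (ha : a ∈ T) : ∃ c : K, algebraMap K L c = a := by
  let _ : Algebra k L := ((algebraMap K L).comp (algebraMap k K)).toAlgebra
  have : IsScalarTower k K L := IsScalarTower.of_algebraMap_eq' rfl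
  have : Algebra.EssFiniteType k L := Algebra.EssFiniteType.comp k K L
  set d := Module.finrank K L with hd
  have hd0 : d ≠ 0 := Module.finrank_pos.ne'
  have hN : ∀ {b : L}, b ≠ 0 → algebraMap K L (Algebra.norm K b) ≠ 0 := fun hb => by
    simpa using hb
  have key : ∀ b ∈ T, ∃ c : K, algebraMap K L c = b ^ d := by
    intro b hb
    have hb0 := h0 b hb
    -- The map sending `b` to `b ^ d` over its norm is multiplicative and kills `K`, so it turns
    -- divisibility modulo `K` into honest roots.
    obtain ⟨c, hc⟩ := mem_range_algebraMap_of_forall_exists_pow (k := k)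
      (x := b ^ d / algebraMap K L (Algebra.norm K b)) (by
        intro e he
        obtain ⟨y, hy, c, rfl⟩ := hT b hb e he
        have hc : algebraMap K L c ≠ 0 := left_ne_zero_of_mul hb0
        have hy0 := hN (h0 y hy)
        refine ⟨y ^ d / algebraMap K L (Algebra.norm K y), ?_⟩
        rw [map_mul, map_pow, Algebra.norm_algebraMap, ← hd, map_mul, map_pow, map_pow, div_pow,
          div_eq_div_iff (pow_ne_zero _ hy0) (mul_ne_zero (pow_ne_zero _ hc) (pow_ne_zero _ hy0))]
        ring)
    refine ⟨algebraMap k K c * Algebra.norm K b, ?_⟩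
    rw [map_mul, ← IsScalarTower.algebraMap_apply, hc, div_mul_cancel₀ _ (hN hb0)]
  obtain ⟨b, hb, c, rfl⟩ := hT a ha d hd0
  obtain ⟨c', hc'⟩ := key b hb
  exact ⟨c * c', by rw [map_mul, hc']⟩

end InfinitelyDivisible

/-! ### Conjugators and divisible abelian actions -/

section InnerActions

variable {K D : Type*} [Field K] [DivisionRing D] [Algebra K D]

/-- The map `φ` is conjugation by the unit `a`. -/
def IsConjBy {D : Type*} [Monoid D] (φ : D → D) (a : Dˣ) : Prop :=
  ∀ x : D, φ x = (a : D) * x * ((a⁻¹ : Dˣ) : D)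

theorem IsConjBy.exists_eq_algebraMap_mul [Algebra.IsCentral K D] {φ : D → D} {a b : Dˣ}
    (ha : IsConjBy φ a) (hb : IsConjBy φ b) : ∃ c : K, (a : D) = algebraMap K D c * b := by
  have hmem : (a : D) * ((b⁻¹ : Dˣ) : D) ∈ Subalgebra.center K D := by
    rw [Subalgebra.mem_center_iff]
    intro x
    have h := (ha (((b⁻¹ : Dˣ) : D) * x * b)).symm.trans (hb _)
    have h2 : (a : D) * ((b⁻¹ : Dˣ) : D) * x * ((b : D) * ((a⁻¹ : Dˣ) : D)) = x := by
      simpa [mul_assoc] using h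
    have h3 := congrArg (fun y => y * ((a : D) * ((b⁻¹ : Dˣ) : D))) h2
    simpa [mul_assoc] using h3.symm
  obtain ⟨c, hc⟩ := (Algebra.IsCentral.mem_center_iff K).1 hmem
  exact ⟨c, by rw [← hc, mul_assoc, Units.inv_mul, mul_one]⟩

theorem IsConjBy.eq_self_of_algebraMap {φ : D → D} {a : Dˣ} (ha : IsConjBy φ a) {c : K}
    (hc : algebraMap K D c = a) (x : D) : φ x = x := by
  rw [ha, ← hc, Algebra.commutes, hc, mul_assoc, Units.mul_inv, mul_one]

/-- Compare norms: `Algebra.norm`, the determinant of left multiplication, is multiplicative even on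
the noncommutative `D`. -/
theorem pow_finrank_eq_one_of_mul_eq [FiniteDimensional K D] {a b : D} (ha : a ≠ 0) (hb : b ≠ 0)
    {z : K} (h : a * b = algebraMap K D z * (b * a)) : z ^ Module.finrank K D = 1 := by
  have h1 := congrArg (Algebra.norm K) h
  rw [map_mul, map_mul, map_mul, Algebra.norm_algebraMap, mul_comm (Algebra.norm K b)] at h1
  have hu : IsUnit (Algebra.norm K a * Algebra.norm K b) :=
    ((IsUnit.mk0 a ha).map _).mul ((IsUnit.mk0 b hb).map _)
  exact hu.mul_right_cancel (by rw [one_mul, ← h1])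

theorem mul_pow_eq_of_mul_eq {a b : D} {z : K} (h : a * b = algebraMap K D z * (b * a)) (j : ℕ) :
    a * b ^ j = algebraMap K D (z ^ j) * (b ^ j * a) := by
  induction j with
  | zero => simp
  | succ j ih =>
    rw [pow_succ, ← mul_assoc, ih, mul_assoc, mul_assoc, h, pow_succ, map_mul,
      ← mul_assoc (b ^ j) (algebraMap K D z), ← Algebra.commutes z (b ^ j)]
    simp only [mul_assoc]

variable {k : Type*} [Field k] [Algebra k K] [Algebra k D]

theorem IsConjBy.mul {φ ψ : D ≃ₐ[k] D} {a b : Dˣ} (ha : IsConjBy φ a) (hb : IsConjBy ψ b) :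
    IsConjBy (φ * ψ : D ≃ₐ[k] D) (a * b) := by
  intro x
  rw [AlgEquiv.mul_apply, hb, ha]
  simp [mul_assoc]

theorem IsConjBy.one : IsConjBy ((1 : D ≃ₐ[k] D) : D → D) (1 : Dˣ) := by
  intro x
  simp

theorem IsConjBy.pow {φ : D ≃ₐ[k] D} {a : Dˣ} (ha : IsConjBy φ a) (e : ℕ) :
    IsConjBy (φ ^ e : D ≃ₐ[k] D) (a ^ e) := by
  induction e with
  | zero =>
    rw [pow_zero, pow_zero]
    exact IsConjBy.one
  | succ e ih =>
    rw [pow_succ, pow_succ]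
    exact ih.mul ha

theorem IsConjBy.inv {φ : D ≃ₐ[k] D} {a : Dˣ} (ha : IsConjBy φ a) :
    IsConjBy (φ⁻¹ : D ≃ₐ[k] D) a⁻¹ := by
  intro x
  apply φ.injective
  rw [ha (_ * x * _), show φ (φ⁻¹ x) = x from φ.apply_symm_apply x]
  simp [mul_assoc]

/-- A divisible abelian group acting by inner automorphisms acts trivially. -/
theorem eq_one_of_divisible [IsAlgClosed k] [Algebra.EssFiniteType k K]
    [Algebra.IsCentral K D] [FiniteDimensional K D] {A : Type*} [Group A]
    (hcomm : ∀ a b : A, a * b = b * a) (hdiv : ∀ e : ℕ, e ≠ 0 → ∀ a : A, ∃ b : A, b ^ e = a)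
    (ρ : A →* (D ≃ₐ[k] D)) (hρ : ∀ g, IsInnerAut (ρ g)) (g : A) : ρ g = 1 := by
  let T : Set D := {x | ∃ g : A, ∃ a : Dˣ, IsConjBy (ρ g) a ∧ (a : D) = x}
  have hdivT : ∀ {g : A} {a : Dˣ}, IsConjBy (ρ g) a → ∀ e : ℕ, e ≠ 0 → ∃ h : A, ∃ b : Dˣ,
      IsConjBy (ρ h) b ∧ ∃ c : K, (a : D) = algebraMap K D c * (b : D) ^ e := by
    intro g a ha e he
    obtain ⟨h, rfl⟩ := hdiv e he g
    obtain ⟨b, hb⟩ := hρ h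
    refine ⟨h, b, hb, ?_⟩
    rw [map_pow] at ha
    simpa using ha.exists_eq_algebraMap_mul (K := K) (IsConjBy.pow hb e)
  -- Up to a scalar, `b` is a power of `b'` with exponent the dimension of `D`, and this exponent
  -- kills the commutation scalar `z` of `a` and `b'`.
  have hT : ∀ x ∈ T, ∀ y ∈ T, x * y = y * x := by
    rintro _ ⟨g, a, ha, rfl⟩ _ ⟨h, b, hb, rfl⟩
    obtain ⟨h', b', hb', c, hc⟩ := hdivT hb (Module.finrank K D) Module.finrank_pos.ne'
    have h1 := ha.mul hb'
    have h2 := hb'.mul ha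
    rw [← map_mul, hcomm, map_mul] at h1
    obtain ⟨z, hz⟩ := h1.exists_eq_algebraMap_mul (K := K) h2
    rw [Units.val_mul, Units.val_mul] at hz
    have h3 := mul_pow_eq_of_mul_eq hz (Module.finrank K D)
    rw [pow_finrank_eq_one_of_mul_eq a.ne_zero b'.ne_zero hz, map_one, one_mul] at h3
    rw [hc, ← mul_assoc, ← Algebra.commutes, mul_assoc, h3, mul_assoc]
  obtain ⟨a, ha⟩ := hρ g
  let L := Algebra.adjoin K T
  have hLc : IsMulCommutative L := Algebra.isMulCommutative_adjoin K hT
  let _ : CommRing L := { (inferInstance : Ring L) with mul_comm := hLc.is_comm.comm }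
  -- A commutative domain integral over a field is a field.
  have hLF : IsField L := isField_of_isIntegral_of_isField' (R := K) (Field.toIsField K)
  let _ : Field L := hLF.toField
  obtain ⟨c, hc⟩ := mem_range_algebraMap_of_divisible_mod (k := k) (K := K) (L := L)
    (T := {x | (x : D) ∈ T}) (a := ⟨a, Algebra.subset_adjoin ⟨g, a, ha, rfl⟩⟩) (by
      rintro ⟨_, _⟩ ⟨g, a, ha, rfl⟩ h
      exact a.ne_zero (congrArg Subtype.val h)) (by
      rintro ⟨_, _⟩ ⟨g, a, ha, rfl⟩ e he
      obtain ⟨h, b, hb, c, hc⟩ := hdivT ha e he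
      exact ⟨⟨b, Algebra.subset_adjoin ⟨h, b, hb, rfl⟩⟩, ⟨h, b, hb, rfl⟩, c, Subtype.ext hc⟩)
    ⟨g, a, ha, rfl⟩
  ext x
  exact IsConjBy.eq_self_of_algebraMap ha (congrArg Subtype.val hc) x

end InnerActions

/-! ### Eigenspaces of conjugation and orders modulo the centre -/

section KummerTheory

theorem mem_range_algebraMap_of_pow_eq_one {k D : Type*} [Field k] [IsAlgClosed k] [DivisionRing D]
    [Algebra k D] {x : D} {r : ℕ} (hr : r ≠ 0) (hx : x ^ r = 1) : ∃ c : k, algebraMap k D c = x := by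
  have hint : IsIntegral k x := ⟨Polynomial.X ^ r - 1, Polynomial.monic_X_pow_sub_C 1 hr, by
    simp [hx]⟩
  exact minpoly.mem_range_of_degree_eq_one k x
    (IsAlgClosed.degree_eq_one_of_irreducible k (minpoly.irreducible hint))

open Module in
/-- An endomorphism of finite order `d` is diagonalizable over a field containing a primitive
`d`-th root of unity. -/
theorem iSup_eigenspace_eq_top_of_pow_eq_one {K V : Type*} [Field K] [AddCommGroup V] [Module K V]
    {d : ℕ} (hd : (d : K) ≠ 0) {ζ : K} (hζ : IsPrimitiveRoot ζ d) {σ : End K V} (hσ : σ ^ d = 1) :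
    ⨆ μ : K, End.eigenspace σ μ = ⊤ := by
  have hd0 : d ≠ 0 := fun h => hd (by simp [h])
  refine eq_top_iff.2 fun x _ => ?_
  -- `v i` is `d` times the projection of `x` to the eigenspace of `ζ ^ i`; orthogonality of
  -- characters sums these to `d • x`.
  let v : ℕ → V := fun i => ∑ j ∈ Finset.range d, (ζ⁻¹ ^ (i * j)) • (σ ^ j) x
  have hζ0 : ζ ≠ 0 := hζ.ne_zero hd0
  have hv : ∀ i, v i ∈ End.eigenspace σ (ζ ^ i) := by
    intro i
    rw [End.mem_eigenspace_iff]
    have hstep : ∀ j, σ ((ζ⁻¹ ^ (i * j)) • (σ ^ j) x) =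
        ζ ^ i • ((ζ⁻¹ ^ (i * (j + 1))) • (σ ^ (j + 1)) x) := by
      intro j
      rw [map_smul, smul_smul, pow_succ' σ, Module.End.mul_apply]
      congr 1
      rw [mul_add, mul_one, pow_add, mul_left_comm, ← mul_pow, mul_inv_cancel₀ hζ0, one_pow, mul_one]
    simp only [v, map_sum, hstep, ← Finset.smul_sum]
    congr 1
    have h1 := Finset.sum_range_succ (fun j => (ζ⁻¹ ^ (i * j)) • (σ ^ j) x) d
    have h2 := Finset.sum_range_succ' (fun j => (ζ⁻¹ ^ (i * j)) • (σ ^ j) x) d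
    have h3 : (ζ⁻¹ ^ (i * d)) • (σ ^ d) x = (ζ⁻¹ ^ (i * 0)) • (σ ^ 0) x := by
      rw [hσ, mul_comm, pow_mul, inv_pow, hζ.pow_eq_one]
      simp
    rw [h2, h3] at h1
    exact add_right_cancel h1
  have hsum : ∑ i ∈ Finset.range d, v i = (d : K) • x := by
    simp only [v]
    rw [Finset.sum_comm]
    simp only [← Finset.sum_smul]
    rw [Finset.sum_eq_single_of_mem 0 (Finset.mem_range.2 (Nat.pos_of_ne_zero hd0))]
    · simp
    · intro j hj hj0
      have hne : ζ⁻¹ ^ j ≠ 1 := by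
        rw [inv_pow, ne_eq, inv_eq_one]
        exact hζ.pow_ne_one_of_pos_of_lt hj0 (Finset.mem_range.1 hj)
      have hgeom : ∑ i ∈ Finset.range d, ζ⁻¹ ^ (i * j) = 0 := by
        have h := mul_geom_sum (ζ⁻¹ ^ j) d
        rw [← pow_mul, mul_comm j d, pow_mul, inv_pow ζ d, hζ.pow_eq_one, inv_one, one_pow,
          sub_self] at h
        have h' := (mul_eq_zero.1 h).resolve_left (sub_ne_zero.2 hne)
        simpa only [← pow_mul, mul_comm j] using h'
      rw [hgeom, zero_smul]
  have hx : x = (d : K)⁻¹ • ∑ i ∈ Finset.range d, v i := by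
    rw [hsum, smul_smul, inv_mul_cancel₀ hd, one_smul]
  rw [hx]
  exact Submodule.smul_mem _ _ (Submodule.sum_mem _ fun i _ => Submodule.mem_iSup_of_mem _ (hv i))

variable {K D : Type*} [Field K] [DivisionRing D] [Algebra K D]

/-- Conjugation by a unit, as a linear map. -/
def conjEnd (K : Type*) {D : Type*} [Field K] [DivisionRing D] [Algebra K D] (a : Dˣ) :
    Module.End K D :=
  LinearMap.mulLeft K (a : D) * LinearMap.mulRight K ((a⁻¹ : Dˣ) : D)

theorem conjEnd_apply (a : Dˣ) (x : D) : conjEnd K a x = (a : D) * x * ((a⁻¹ : Dˣ) : D) := by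
  simp [conjEnd, mul_assoc]

theorem conjEnd_pow_apply (a : Dˣ) (j : ℕ) (x : D) :
    (conjEnd K a ^ j) x = ((a ^ j : Dˣ) : D) * x * (((a ^ j)⁻¹ : Dˣ) : D) := by
  induction j generalizing x with
  | zero => simp
  | succ j ih =>
    rw [pow_succ, Module.End.mul_apply, ih, conjEnd_apply, pow_succ a, mul_inv_rev]
    simp only [Units.val_mul, mul_assoc]

theorem conjEnd_pow_eq_one_iff [Algebra.IsCentral K D] (a : Dˣ) (j : ℕ) :
    conjEnd K a ^ j = 1 ↔ ∃ c : K, algebraMap K D c = (a : D) ^ j := by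
  constructor
  · intro h
    have h1 : IsConjBy (id : D → D) (a ^ j) := fun x => by
      rw [← conjEnd_pow_apply (K := K), h]
      rfl
    obtain ⟨c, hc⟩ := h1.exists_eq_algebraMap_mul (K := K) (b := 1) (fun x => by simp)
    exact ⟨c, by simpa using hc.symm⟩
  · rintro ⟨c, hc⟩
    ext x
    exact IsConjBy.eq_self_of_algebraMap (fun x => conjEnd_pow_apply (K := K) a j x)
      (hc.trans (by simp)) x

/-- The eigenvalues of conjugation by a unit form a group. -/
def conjEigenvalues (K : Type*) {D : Type*} [Field K] [DivisionRing D] [Algebra K D] (a : Dˣ) :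
    Subgroup Kˣ where
  carrier := {μ | ∃ x : D, x ≠ 0 ∧ (a : D) * x * ((a⁻¹ : Dˣ) : D) = algebraMap K D μ * x}
  one_mem' := ⟨1, one_ne_zero, by simp⟩
  mul_mem' := by
    rintro μ ν ⟨x, hx, hμ⟩ ⟨y, hy, hν⟩
    refine ⟨x * y, mul_ne_zero hx hy, ?_⟩
    have h : (a : D) * (x * y) * ((a⁻¹ : Dˣ) : D) =
        ((a : D) * x * ((a⁻¹ : Dˣ) : D)) * ((a : D) * y * ((a⁻¹ : Dˣ) : D)) := by
      simp [mul_assoc]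
    rw [h, hμ, hν, Units.val_mul, map_mul, mul_assoc, ← mul_assoc x, ← Algebra.commutes]
    simp only [mul_assoc]
  inv_mem' := by
    rintro μ ⟨x, hx, hμ⟩
    refine ⟨x⁻¹, inv_ne_zero hx, ?_⟩
    have h := congrArg (fun z => z⁻¹) hμ
    simp only [mul_inv_rev] at h
    rw [← map_inv₀, ← Algebra.commutes, ← Units.val_inv_eq_inv_val, ← Units.val_inv_eq_inv_val,
      ← Units.val_inv_eq_inv_val, inv_inv, ← mul_assoc] at h
    exact h

theorem mem_conjEigenvalues {a : Dˣ} {μ : Kˣ} :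
    μ ∈ conjEigenvalues K a ↔ (conjEnd K a).HasEigenvalue (μ : K) := by
  rw [Module.End.HasEigenvalue, Module.End.HasUnifEigenvalue, Submodule.ne_bot_iff]
  constructor
  · rintro ⟨x, hx, h⟩
    exact ⟨x, Module.End.mem_eigenspace_iff.2 (by rw [conjEnd_apply, h, Algebra.smul_def]), hx⟩
  · rintro ⟨x, h, hx⟩
    have := Module.End.mem_eigenspace_iff.1 h
    exact ⟨x, hx, by rw [← conjEnd_apply (K := K), this, Algebra.smul_def]⟩

instance finite_conjEigenvalues [FiniteDimensional K D] (a : Dˣ) : Finite (conjEigenvalues K a) := by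
  refine Finite.of_injective (β := (conjEnd K a).Eigenvalues)
    (fun μ => ⟨(μ : Kˣ), mem_conjEigenvalues.1 μ.2⟩) ?_
  intro μ ν h
  exact Subtype.ext (Units.ext (congrArg Subtype.val h))

/-- Left multiplication by an eigenvector for `μ` carries the centralizer of `a`, which is the
eigenspace of `1`, onto the eigenspace of `μ`. -/
theorem finrank_eigenspace_conjEnd {a : Dˣ} {μ : Kˣ} (hμ : μ ∈ conjEigenvalues K a) :
    Module.finrank K ((conjEnd K a).eigenspace (μ : K)) =
      Module.finrank K (Subalgebra.centralizer K {(a : D)}) := by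
  obtain ⟨x, hx, h⟩ := hμ
  have hmem : ∀ y, y ∈ Subalgebra.centralizer K {(a : D)} ↔
      x * y ∈ (conjEnd K a).eigenspace (μ : K) := by
    intro y
    have h1 : (a : D) * x = algebraMap K D μ * x * a := by
      rw [← h]
      simp [mul_assoc]
    rw [Subalgebra.mem_centralizer_iff, Module.End.mem_eigenspace_iff, conjEnd_apply,
      Algebra.smul_def, Units.mul_inv_eq_iff_eq_mul, ← mul_assoc, h1]
    simp only [Set.mem_singleton_iff, forall_eq, mul_assoc]
    have hμ0 : algebraMap K D μ ≠ 0 := by simp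
    exact ⟨fun e => by rw [e], fun e => mul_left_cancel₀ hx (mul_left_cancel₀ hμ0 e)⟩
  let f : Subalgebra.centralizer K {(a : D)} →ₗ[K] (conjEnd K a).eigenspace (μ : K) :=
    ((LinearMap.mulLeft K x).comp (Subalgebra.centralizer K {(a : D)}).val.toLinearMap).codRestrict
      _ (fun y => (hmem y).1 y.2)
  refine (LinearEquiv.ofBijective f ⟨?_, ?_⟩).finrank_eq.symm
  · intro y z hyz
    exact Subtype.ext (mul_left_cancel₀ hx (congrArg Subtype.val hyz))
  · rintro ⟨y, hy⟩
    refine ⟨⟨x⁻¹ * y, (hmem _).2 ?_⟩, Subtype.ext ?_⟩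
    · rwa [mul_inv_cancel_left₀ hx]
    · exact mul_inv_cancel_left₀ hx y

theorem finrank_eq_card_conjEigenvalues_mul [FiniteDimensional K D] {a : Dˣ}
    (h : ⨆ μ : K, (conjEnd K a).eigenspace μ = ⊤) :
    Module.finrank K D = Nat.card (conjEigenvalues K a) *
      Module.finrank K (Subalgebra.centralizer K {(a : D)}) := by
  classical
  let A : conjEigenvalues K a → Submodule K D := fun μ => (conjEnd K a).eigenspace ((μ : Kˣ) : K)
  have hind : iSupIndep A := (Module.End.eigenspaces_iSupIndep (conjEnd K a)).comp
    (f := fun μ : conjEigenvalues K a => ((μ : Kˣ) : K))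
    (fun μ ν h => Subtype.ext (Units.ext h))
  have htop : iSup A = ⊤ := by
    rw [eq_top_iff, ← h]
    refine iSup_le fun μ => ?_
    by_cases hμ : (conjEnd K a).eigenspace μ = ⊥
    · rw [hμ]
      exact bot_le
    · have hμ0 : μ ≠ 0 := by
        rintro rfl
        refine hμ (eq_bot_iff.2 fun x hx => ?_)
        have hx' := Module.End.mem_eigenspace_iff.1 hx
        rw [conjEnd_apply, zero_smul] at hx'
        simpa using hx'
      exact le_iSup A ⟨Units.mk0 μ hμ0, mem_conjEigenvalues.2 hμ⟩
  have hint := DirectSum.isInternal_submodule_of_iSupIndep_of_iSup_eq_top hind htop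
  have := Fintype.ofFinite (conjEigenvalues K a)
  rw [← (LinearEquiv.ofBijective (DirectSum.coeLinearMap A) hint).finrank_eq,
    Module.finrank_directSum, Finset.sum_congr rfl fun μ _ => finrank_eigenspace_conjEnd μ.2,
    Finset.sum_const, Finset.card_univ, smul_eq_mul, Nat.card_eq_fintype_card]

/-- In a division algebra of degree `n` over a field `K` containing an algebraically closed field
of characteristic zero, the order of an element modulo `K`, if finite, divides `n`. -/
theorem exists_algebraMap_eq_pow_degree {k : Type*} [Field k] [IsAlgClosed k] [CharZero k]
    [Algebra k K] [Algebra k D] [IsScalarTower k K D] [Algebra.IsCentral K D]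
    [FiniteDimensional K D] {n : ℕ}
    (hn : Module.finrank K D = n ^ 2) (a : Dˣ) {r : ℕ} (hr : r ≠ 0)
    (ha : ∃ c : K, algebraMap K D c = (a : D) ^ r) :
    ∃ c : K, algebraMap K D c = (a : D) ^ n := by
  set σ := conjEnd K a with hσ
  have hfin : IsOfFinOrder σ :=
    isOfFinOrder_iff_pow_eq_one.2 ⟨r, Nat.pos_of_ne_zero hr, (conjEnd_pow_eq_one_iff a r).2 ha⟩
  set d := orderOf σ with hd
  have hd0 : d ≠ 0 := hfin.orderOf_pos.ne'
  have hσd : σ ^ d = 1 := pow_orderOf_eq_one σ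
  have hdvd : ∀ j, (∃ c : K, algebraMap K D c = (a : D) ^ j) → d ∣ j := fun j hj =>
    orderOf_dvd_of_pow_eq_one ((conjEnd_pow_eq_one_iff a j).2 hj)
  have : CharZero K := charZero_of_injective_algebraMap (algebraMap k K).injective
  have hdk : NeZero (d : k) := ⟨Nat.cast_ne_zero.2 hd0⟩
  obtain ⟨ζ, hζ⟩ := HasEnoughRootsOfUnity.exists_primitiveRoot k d
  have htop := iSup_eigenspace_eq_top_of_pow_eq_one (Nat.cast_ne_zero.2 hd0)
    (hζ.map_of_injective (algebraMap k K).injective) hσd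
  -- `σ` is diagonalizable and its eigenvalues form a finite group, so the order of that group
  -- annihilates `σ`.
  have h1 : d ∣ Nat.card (conjEigenvalues K a) := by
    refine orderOf_dvd_of_pow_eq_one (LinearMap.ext fun x => ?_)
    have hx : x ∈ ⨆ μ : K, σ.eigenspace μ := htop ▸ Submodule.mem_top
    induction hx using Submodule.iSup_induction' with
    | mem μ x hx =>
      by_cases hx0 : x = 0
      · rw [hx0, map_zero, map_zero]
      · have hx' := Module.End.mem_eigenspace_iff.1 hx
        have hμ0 : μ ≠ 0 := by
          rintro rfl
          rw [hσ, conjEnd_apply, zero_smul] at hx'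
          simp at hx'
          exact hx0 hx'
        have hμ : Units.mk0 μ hμ0 ∈ conjEigenvalues K a := mem_conjEigenvalues.2
          (Module.End.hasEigenvalue_of_hasEigenvector ⟨hx, hx0⟩)
        have hpow : μ ^ Nat.card (conjEigenvalues K a) = 1 := by
          have := pow_card_eq_one' (x := (⟨_, hμ⟩ : conjEigenvalues K a))
          exact congrArg (fun ν : conjEigenvalues K a => ((ν : Kˣ) : K)) this
        have hj : ∀ j : ℕ, (σ ^ j) x = μ ^ j • x := by
          intro j
          induction j with
          | zero => simp
          | succ j ih => rw [pow_succ, Module.End.mul_apply, hx', map_smul, ih, smul_smul, pow_succ']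
        rw [hj, hpow, one_smul, Module.End.one_apply]
    | zero => rw [map_zero, map_zero]
    | add x y _ _ hx hy => rw [map_add, map_add, hx, hy]
  -- Let `N` be the norm of `a` in its centralizer, of dimension `s`. With `a ^ d = c`, one gets `N
  -- ^ d = c ^ s`, so `a ^ s / N` is a root of unity, hence in `k`, and `a ^ s` lies in `K`.
  have h2 : d ∣ Module.finrank K (Subalgebra.centralizer K {(a : D)}) := by
    set C := Subalgebra.centralizer K {(a : D)} with hC
    set s := Module.finrank K C with hs
    let a' : C := ⟨a, by simp [hC, Subalgebra.mem_centralizer_iff]⟩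
    obtain ⟨c, hc⟩ := (conjEnd_pow_eq_one_iff a d).1 hσd
    have hc' : a' ^ d = algebraMap K C c := Subtype.ext hc.symm
    set N := Algebra.norm K a' with hN
    have hNd : N ^ d = c ^ s := by rw [hN, ← map_pow, hc', Algebra.norm_algebraMap]
    have hc0 : c ≠ 0 := by
      rintro rfl
      rw [map_zero] at hc
      exact pow_ne_zero d a.ne_zero hc.symm
    have hN0 : N ≠ 0 := by
      intro h
      rw [h, zero_pow hd0] at hNd
      exact pow_ne_zero s hc0 hNd.symm
    obtain ⟨ξ, hξ⟩ := mem_range_algebraMap_of_pow_eq_one (k := k) hd0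
      (D := D) (x := (a : D) ^ s * algebraMap K D N⁻¹) (by
        rw [(Algebra.commute_algebraMap_right N⁻¹ ((a : D) ^ s)).mul_pow, ← pow_mul, mul_comm s d, pow_mul,
          ← hc, ← map_pow, ← map_pow, ← map_mul, inv_pow, hNd,
          mul_inv_cancel₀ (pow_ne_zero s hc0), map_one])
    refine hdvd s ⟨algebraMap k K ξ * N, ?_⟩
    rw [map_mul, ← IsScalarTower.algebraMap_apply, hξ, mul_assoc, ← map_mul,
      inv_mul_cancel₀ hN0, map_one, mul_one]
  have h3 : d ∣ n := by
    rw [← Nat.pow_dvd_pow_iff two_ne_zero, ← hn, finrank_eq_card_conjEigenvalues_mul htop, pow_two]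
    exact mul_dvd_mul h1 h2
  exact (conjEnd_pow_eq_one_iff a n).1 (orderOf_dvd_iff_pow_eq_one.1 h3)

end KummerTheory

/-! ### Commutativity of a finite quotient -/

open scoped commutatorElement in
/-- If a group acts by inner automorphisms through a finite quotient, then the quotient is
abelian. -/
theorem map_mul_comm_of_finite_quotient {k K D : Type*} [Field k] [IsAlgClosed k] [Field K]
    [Algebra k K] [DivisionRing D] [Algebra k D] [Algebra K D] [IsScalarTower k K D]
    [Algebra.IsCentral K D] {G : Type*} [Group G] (ρ : G →* (D ≃ₐ[k] D))
    (hρ : ∀ g, IsInnerAut (ρ g)) [Finite (G ⧸ ρ.ker)] (g h : G) : ρ (g * h) = ρ (h * g) := by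
  let T : Subgroup Dˣ :=
    { carrier := {a | ∃ g : G, IsConjBy (ρ g) a}
      one_mem' := ⟨1, by rw [map_one]; exact IsConjBy.one⟩
      mul_mem' := by
        rintro a b ⟨g, hg⟩ ⟨h, hh⟩
        exact ⟨g * h, by rw [map_mul]; exact hg.mul hh⟩
      inv_mem' := by
        rintro a ⟨g, hg⟩
        exact ⟨g⁻¹, by rw [map_inv]; exact hg.inv⟩ }
  choose l hl' using hρ
  have hl : ∀ g, IsConjBy (ρ g) (l g) := hl'
  let lT : G ⧸ ρ.ker → T := fun q => ⟨l q.out, q.out, hl q.out⟩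
  have hcomm : ∀ u : T, ∃ q : G ⧸ ρ.ker, ∃ z : T, z ∈ Subgroup.center T ∧ u = z * lT q := by
    rintro ⟨a, g, hg⟩
    have hout : ρ (g : G ⧸ ρ.ker).out = ρ g := by
      have := QuotientGroup.eq.1 (QuotientGroup.out_eq' (g : G ⧸ ρ.ker))
      rw [MonoidHom.mem_ker, map_mul, map_inv, inv_mul_eq_one] at this
      exact this
    have hgl := hl (g : G ⧸ ρ.ker).out
    rw [hout] at hgl
    obtain ⟨c, hc⟩ := IsConjBy.exists_eq_algebraMap_mul (K := K) hg hgl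
    refine ⟨g, ⟨a, g, hg⟩ * (lT g)⁻¹, ?_, by rw [inv_mul_cancel_right]⟩
    rw [Subgroup.mem_center_iff]
    intro t
    refine Subtype.ext (Units.ext ?_)
    have hz : (a : D) * (((l (g : G ⧸ ρ.ker).out)⁻¹ : Dˣ) : D) = algebraMap K D c := by
      rw [hc, mul_assoc, Units.mul_inv, mul_one]
    change ((t : Dˣ) : D) * ((a : D) * _) = ((a : D) * _) * ((t : Dˣ) : D)
    have hlt : (((lT g)⁻¹ : T) : Dˣ) = (l (g : G ⧸ ρ.ker).out)⁻¹ := rfl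
    rw [hlt, hz, Algebra.commutes]
  -- Commutators depend only on classes modulo the centre, and finitely many representatives `lT q`
  -- suffice. Schur's theorem then makes the commutator subgroup finite.
  have hfin : Finite (commutatorSet T) := by
    refine ((Set.finite_range fun p : (G ⧸ ρ.ker) × (G ⧸ ρ.ker) => ⁅lT p.1, lT p.2⁆).subset
      ?_).to_subtype
    rintro _ ⟨u, v, rfl⟩
    obtain ⟨p, y, hy, rfl⟩ := hcomm u
    obtain ⟨q, z, hz, rfl⟩ := hcomm v
    refine ⟨(p, q), ?_⟩
    have hyz := Subgroup.mem_center_iff.1 ((Subgroup.center T).mul_mem hy hz)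
    rw [Subgroup.mem_center_iff] at hy hz
    have h1 : y * lT p * (z * lT q) = lT p * lT q * (y * z) := by
      rw [hyz, mul_assoc, ← mul_assoc (lT p), hz]
      simp only [mul_assoc]
    have h2 : z * lT q * (y * lT p) = lT q * lT p * (y * z) := by
      rw [hyz, mul_assoc, ← mul_assoc (lT q), hy, ← mul_assoc, ← mul_assoc, ← hy z]
      simp only [mul_assoc]
    change ⁅lT p, lT q⁆ = ⁅y * lT p, z * lT q⁆
    rw [commutatorElement_def, commutatorElement_def, mul_assoc (_ * _), ← mul_inv_rev,
      mul_assoc (_ * _), ← mul_inv_rev, h1, h2]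
    group
  let u : T := ⟨l g, g, hl g⟩
  let v : T := ⟨l h, h, hl h⟩
  have hmem : ⁅u, v⁆ ∈ commutator T := Subgroup.commutator_mem_commutator
    (Subgroup.mem_top u) (Subgroup.mem_top v)
  have hord : IsOfFinOrder (⟨_, hmem⟩ : commutator T) := isOfFinOrder_of_finite _
  obtain ⟨r, hr, hr1⟩ := isOfFinOrder_iff_pow_eq_one.1 hord
  have hr2 : ((⁅u, v⁆ : T) ^ r : T) = 1 := congrArg Subtype.val hr1
  have hr3 : (((⁅u, v⁆ : T) : Dˣ) : D) ^ r = 1 := by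
    rw [← Units.val_pow_eq_pow_val, ← Subgroup.coe_pow, hr2]
    rfl
  obtain ⟨c, hc⟩ := mem_range_algebraMap_of_pow_eq_one (k := k) hr.ne' hr3
  have hconj : IsConjBy (ρ ⁅g, h⁆) ((⁅u, v⁆ : T) : Dˣ) := by
    rw [map_commutatorElement, commutatorElement_def]
    exact (((hl g).mul (hl h)).mul (hl g).inv).mul (hl h).inv
  have hone : ρ ⁅g, h⁆ = 1 := by
    ext x
    exact hconj.eq_self_of_algebraMap (K := K) (c := algebraMap k K c)
      (by rw [← IsScalarTower.algebraMap_apply, hc]) x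
  rw [map_commutatorElement, commutatorElement_eq_one_iff_mul_comm] at hone
  rw [map_mul, map_mul, hone]

/-! ### Divisible subgroups and the conclusion -/

/-- Every element of a linear algebraic group in characteristic zero has a power in a divisible
abelian subgroup. -/
theorem exists_pow_mem_divisible {k : Type*} [Field k] [IsAlgClosed k] [CharZero k] {m : ℕ}
    {G : Subgroup (GL (Fin m) k)} (hG : IsLinearAlgebraicGroup G) {g : GL (Fin m) k} (hg : g ∈ G) :
    ∃ Z : Subgroup (GL (Fin m) k), Z ≤ G ∧ (∀ a ∈ Z, ∀ b ∈ Z, a * b = b * a) ∧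
      (∀ e : ℕ, e ≠ 0 → ∀ a ∈ Z, ∃ b ∈ Z, b ^ e = a) ∧ ∃ r : ℕ, r ≠ 0 ∧ g ^ r ∈ Z := by
  let C : Set (GL (Fin m) k) := {x | x ∈ G ∧ x * g = g * x}
  -- The centralizer in `G` of the centralizer of `g` is closed, abelian and contains `g`.
  let A : Subgroup (GL (Fin m) k) := G ⊓ Subgroup.centralizer C
  have hgC : g ∈ C := ⟨hg, rfl⟩
  have hgA : g ∈ A := ⟨hg, Subgroup.mem_centralizer_iff.2 fun x hx => hx.2⟩
  have hAC : ∀ a ∈ A, a ∈ C := fun a ha =>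
    ⟨ha.1, (Subgroup.mem_centralizer_iff.1 ha.2 g hgC).symm⟩
  have hAcomm : ∀ a ∈ A, ∀ b ∈ A, a * b = b * a := fun a ha b hb =>
    Subgroup.mem_centralizer_iff.1 hb.2 a (hAC a ha)
  have hAcl : IsLinearAlgebraicGroup A :=
    @IsClosed.inter _ _ _ (glZariskiTopology k m) hG (isClosed_centralizer_gl C)
  obtain ⟨Z, hZA, hZcl, hZirr, hfin, -⟩ := exists_irreducible_finite_index A hAcl
  have hZcomm : ∀ a ∈ Z, ∀ b ∈ Z, a * b = b * a := fun a ha b hb =>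
    hAcomm a (hZA ha) b (hZA hb)
  refine ⟨Z, hZA.trans inf_le_left, hZcomm, ?_, ?_⟩
  · intro e he a ha
    obtain ⟨x, hx, y, hy, rfl⟩ := exists_pow_mul_inv_pow hZcl hZirr he ha
    refine ⟨x * y⁻¹, Z.mul_mem hx (Z.inv_mem hy), ?_⟩
    have : Commute x y⁻¹ := hZcomm _ hx _ (Z.inv_mem hy)
    rw [this.mul_pow, inv_pow]
  · have hidx : (Z.subgroupOf A).index ≠ 0 := Subgroup.index_ne_zero_of_finite
    obtain ⟨r, hr, -, hmem⟩ := Subgroup.exists_pow_mem_of_index_ne_zero hidx (⟨g, hgA⟩ : A)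
    exact ⟨r, hr.ne', hmem⟩

theorem theoremA1 {k K D : Type*}
    [Field k] [IsAlgClosed k] [CharZero k]
    [Field K] [Algebra k K] (hK : (⊤ : IntermediateField k K).FG)
    [DivisionRing D] [Algebra k D] [Algebra K D] [IsScalarTower k K D]
    [Algebra.IsCentral K D] [FiniteDimensional K D]
    (n : ℕ) (hn : Module.finrank K D = n ^ 2)
    {m : ℕ} (G : Subgroup (GL (Fin m) k)) (hG : IsLinearAlgebraicGroup G)
    (ρ : G →* (D ≃ₐ[k] D)) (hρ : ∀ g : G, IsInnerAut (ρ g)) :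
    identityComponent G ⊆ (ρ.ker : Set G) ∧
      Finite (G ⧸ ρ.ker) ∧
      (∀ a b : G ⧸ ρ.ker, a * b = b * a) ∧
      (∀ a : G ⧸ ρ.ker, a ^ n = 1) := by
  have : Algebra.EssFiniteType k K := IntermediateField.fg_top_iff.1 hK
  have hn0 : n ≠ 0 := by
    rintro rfl
    exact Module.finrank_pos.ne' hn
  have htors : ∀ g : G, ρ (g ^ n) = 1 := by
    intro g
    obtain ⟨Z, hZG, hcomm, hdiv, r, hr, hmem⟩ := exists_pow_mem_divisible hG g.2
    have htriv := eq_one_of_divisible (K := K) (A := Z)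
      (fun a b => Subtype.ext (hcomm a a.2 b b.2))
      (fun e he a => by
        obtain ⟨b, hb, hba⟩ := hdiv e he a a.2
        exact ⟨⟨b, hb⟩, Subtype.ext hba⟩)
      (ρ.comp (Subgroup.inclusion hZG)) (fun z => hρ _) ⟨_, hmem⟩
    have hgr : ρ g ^ r = 1 := by
      rw [← map_pow]
      exact htriv
    obtain ⟨a, ha⟩ := hρ g
    have har : IsConjBy (ρ g ^ r : D ≃ₐ[k] D) (a ^ r) := IsConjBy.pow ha r
    rw [hgr] at har
    obtain ⟨c, hc⟩ := har.exists_eq_algebraMap_mul (K := K) IsConjBy.one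
    obtain ⟨c', hc'⟩ := exists_algebraMap_eq_pow_degree (k := k) hn a hr ⟨c, by simpa using hc.symm⟩
    have han : IsConjBy (ρ g ^ n : D ≃ₐ[k] D) (a ^ n) := IsConjBy.pow ha n
    rw [map_pow]
    ext x
    exact han.eq_self_of_algebraMap (by simpa using hc') x
  obtain ⟨Z, hZG, hZcl, hZirr, hfin, hcomp⟩ := exists_irreducible_finite_index G hG
  -- Each element of `Z` is a quotient of two `n`-th powers, and these act trivially by `htors`.
  have hZker : Z.subgroupOf G ≤ ρ.ker := by
    intro z hz
    obtain ⟨a, ha, b, hb, hab⟩ := exists_pow_mul_inv_pow hZcl hZirr hn0 hz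
    have hz' : z = (⟨a, hZG ha⟩ : G) ^ n * ((⟨b, hZG hb⟩ : G) ^ n)⁻¹ := Subtype.ext hab
    rw [MonoidHom.mem_ker, hz', map_mul, map_inv, htors, htors, inv_one, one_mul]
  have hfinq : Finite (G ⧸ ρ.ker) := by
    refine Finite.of_surjective (Subgroup.quotientMapOfLE hZker) ?_
    intro q
    obtain ⟨g, rfl⟩ := QuotientGroup.mk_surjective q
    exact ⟨(g : G ⧸ Z.subgroupOf G), rfl⟩
  refine ⟨fun x hx => hZker (hcomp hx), hfinq, ?_, ?_⟩
  · intro a b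
    obtain ⟨g, rfl⟩ := QuotientGroup.mk_surjective a
    obtain ⟨h, rfl⟩ := QuotientGroup.mk_surjective b
    rw [← QuotientGroup.mk_mul, ← QuotientGroup.mk_mul, QuotientGroup.eq, MonoidHom.mem_ker,
      map_mul, map_inv, inv_mul_eq_one]
    exact map_mul_comm_of_finite_quotient (K := K) ρ hρ g h
  · intro a
    obtain ⟨g, rfl⟩ := QuotientGroup.mk_surjective a
    rw [← QuotientGroup.mk_pow, QuotientGroup.eq_one_iff, MonoidHom.mem_ker]
    exact htors g
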